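/- **Graphs.** Let $\mathbb T$ be the set of finite words over $\{1,2\}$ with root the empty word and edges $a\to ak$ ($k\in\{1,2\}$), where $ak$ is $a$ with the letter $k$ appended. Let $\mathbb N^2$ have root $(0,0)$ and edges $b\to bk$, where $(i,j)1:=(i+1,j)$ and $(i,j)2:=(i,j+1)$. In both cases $|\cdot|$ denotes the graph distance from the root. Let $D\in\{\mathbb T,\mathbb N^2\}$ and $n\ge 1$. The game-graph $G_n(D\ltimes\mathbb N^2)$ has as vertices the pairs $(a,b)\in D\times\mathbb N^2$ with $|a|-|b|\in\{0,1\}$ and $|a|+|b|\le n$, and as root $0$ the pair of the two roots. A vertex with $|a|+|b|<n$ is internal; it is Alice's turn there if $|a|+|b|$ is even and Bob's turn if it is odd. From an internal vertex Alice moves along an edge $(a,b)\to(ak,b)$ and Bob along an edge $(a,b)\to(a,bk)$, with $k\in\{1,2\}$. The game-graph $G'_n(D\rtimes\mathbb N^2)$ is defined in the same way, except that $|b|-|a|\in\{0,1\}$ is required and Bob moves when $|a|+|b|$ is even and Alice when it is odd. In both cases $\partial G$, the set of possible outcomes, consists of the vertices with $|a|+|b|=n$. **Strategies.** A strategy of a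 player chooses an outgoing edge at each internal vertex where it is that player's turn. Two strategies, one for each player, determine a path from the root to an outcome. Given $x:\partial G\to\{0,1\}$, where $0$ means that Alice wins, a strategy of Alice is winning if for every strategy of Bob the resulting outcome $v$ has $x(v)=0$. **Walks.** A walk $\psi=\psi_0\cdots\psi_l$ of length $l$ in $G$ is a sequence of vertices in which each step $(\psi_{k-1},\psi_k)$, $1\le k\le l$, is an edge or a reversed edge. A step is: *straight-up* (su) along an edge of Alice; *straight-down* (sd) along a reversed edge of Alice; *right-up* (ru) along an edge $(a,b)\to(a,b1)$ of Bob; *left-up* (lu) along an edge $(a,b)\to(a,b2)$ of Bob; *left-down* (ld) along a reversed edge $(a,b1)\to(a,b)$ of Bob; *right-down* (rd) along a reversed edge $(a,b2)\to(a,b)$ of Bob. The types su, lu, ru are called up, and sd, ld, rd are called down. For $0<k<l$, the index $k$ belongs to $N_\uparrow$, $N_\circ$, $N_\downarrow$ or $N_*$ according to whether the $k$-th and the $(k+1)$-th step are up–up, down–up, down–down or up–down, respectively; moreover $0\in N_\uparrow$ and $l\in N_\downarrow$. **Toom cycles.** A *Toom cycle* in $G$ is a walk of length $l\ge 2$ with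 $\psi_0=\psi_l=0$ such that: - the first step is su or ru, and the last step is sd or rd; - for $0<k<l$ with $\psi_k$ internal, the types of the $k$-th and $(k+1)$-th step are one of su→ru, ru→su, lu→su, sd→rd, sd→ld, rd→sd, ld→lu; - for $0<k<l$ with $\psi_k\in\partial G$, they are one of su→sd, ru→rd, ru→ld, lu→rd, lu→ld; - (i) $\psi_k\ne\psi_m$ for all $k,m\in N_*$ with $k\ne m$; - (ii) if $\psi_k=\psi_m$ with $k\in N_s$, $m\in N_t$, $s,t\in\{\uparrow,\circ,\downarrow\}$ and $s\le t$ in the order $\uparrow\,<\circ<\,\downarrow$, then $k\le m$. It is *present* in $(G,x)$ if $x(\psi_k)=0$ for all $0\le k\le l$ with $\psi_k\in\partial G$. **Theorem 2.5.** Let $n\ge1$, let $G$ be any of the game-graphs $G_n(\mathbb T\ltimes\mathbb N^2)$, $G'_n(\mathbb T\rtimes\mathbb N^2)$, $G_n(\mathbb N^2\ltimes\mathbb N^2)$, $G'_n(\mathbb N^2\rtimes\mathbb N^2)$, and let $x:\partial G\to\{0,1\}$. If Alice has a winning strategy given $x$, then a Toom cycle is present in $(G,x)$. -/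

import Mathlib

namespace MinimaxGame

/-! ### Directed graphs -/

/-- There is a directed path with exactly `n` edges from `v` to `w`. -/
def HasPath {V : Type} (E : V → V → Prop) (n : ℕ) (v w : V) : Prop :=
  ∃ p : ℕ → V, p 0 = v ∧ p n = w ∧ ∀ k < n, E (p k) (p (k + 1))

/-- `dist(v, w)`: the smallest length of a directed path from `v` to `w`
(only used when there is such a path). -/
noncomputable def ddist {V : Type} (E : V → V → Prop) (v w : V) : ℕ :=
  sInf {n | HasPath E n v w}

/-! ### Game-graphs, strategies, winning strategies -/

/-- The two players. -/
inductive Player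
  | alice
  | bob

/-- A game-graph: a finite acyclic directed graph, a root from which every vertex can be reached,
and a function that tells whose turn it is in each vertex that has an outgoing edge. -/
structure GameGraph where
  V : Type
  E : V → V → Prop
  root : V
  finite : Finite V
  acyclic : ∀ v, ¬ Relation.TransGen E v v
  reach : ∀ v, Relation.ReflTransGen E root v
  turn : {v : V // ∃ w, E v w} → Player

namespace GameGraph

variable (G : GameGraph)

/-- The non-final states. -/
abbrev Interior : Type := {v : G.V // ∃ w, G.E v w}

/-- The possible outcomes. -/
abbrev Boundary : Type := {v : G.V // ¬ ∃ w, G.E v w}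

/-- The state `v` is non-final and it is the turn of `P`. -/
def IsTurn (P : Player) (v : G.V) : Prop := ∃ h : ∃ w, G.E v w, G.turn ⟨v, h⟩ = P

/-- A pure strategy of the player `P`: an edge out of each non-final state where `P` moves. -/
def Strategy (P : Player) : Type :=
  ∀ v : {v : G.Interior // G.turn v = P}, {w : G.V // G.E v.1.1 w}

variable {G}

/-- The state that follows the non-final state `v` under the two strategies. -/
def next (σ₁ : G.Strategy Player.alice) (σ₂ : G.Strategy Player.bob) (v : G.Interior) :
    {w : G.V // G.E v.1 w} :=
  match h : G.turn v with
  | Player.alice => σ₁ ⟨v, h⟩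
  | Player.bob => σ₂ ⟨v, h⟩

theorem wellFounded_flip (G : GameGraph) : WellFounded (fun w v : G.V => G.E v w) := by
  have := G.finite
  have : IsTrans G.V (fun w v => Relation.TransGen G.E v w) :=
    ⟨fun _ _ _ h1 h2 => h2.trans h1⟩
  have : Std.Irrefl (fun w v : G.V => Relation.TransGen G.E v w) := ⟨G.acyclic⟩
  have h := Finite.wellFounded_of_trans_of_irrefl (fun w v : G.V => Relation.TransGen G.E v w)
  exact Subrelation.wf (fun {_ _} h => Relation.TransGen.single h) h

open Classical in
/-- The possible outcome in which the play ends if the game is in the state `v` and both players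
follow the given strategies: move to the next state until a final state is reached. -/
noncomputable def outcomeFrom (σ₁ : G.Strategy Player.alice) (σ₂ : G.Strategy Player.bob) :
    G.V → G.Boundary :=
  G.wellFounded_flip.fix fun v ih =>
    if h : ∃ w, G.E v w then ih (next σ₁ σ₂ ⟨v, h⟩).1 (next σ₁ σ₂ ⟨v, h⟩).2 else ⟨v, h⟩

open Classical in
theorem outcomeFrom_eq (σ₁ : G.Strategy Player.alice) (σ₂ : G.Strategy Player.bob) (v : G.V) :
    outcomeFrom σ₁ σ₂ v =
      if h : ∃ w, G.E v w then outcomeFrom σ₁ σ₂ (next σ₁ σ₂ ⟨v, h⟩).1 else ⟨v, h⟩ :=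
  G.wellFounded_flip.fix_eq _ v

/-- The outcome of the game under the two strategies. -/
noncomputable def outcome (σ₁ : G.Strategy Player.alice) (σ₂ : G.Strategy Player.bob) :
    G.Boundary :=
  outcomeFrom σ₁ σ₂ G.root

/-- `σ₁` is a winning strategy for Alice, where `x v = 0` means that Alice wins in the outcome `v`
and `x v = 1` means that Bob wins. -/
def IsWinningForAlice (x : G.Boundary → Fin 2) (σ₁ : G.Strategy Player.alice) : Prop :=
  ∀ σ₂ : G.Strategy Player.bob, x (outcome σ₁ σ₂) = 0

end GameGraph

/-! ### Decision graphs -/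

/-- A decision graph. The vertices have finitely many outgoing edges, so that the truncations
of the graph are finite. -/
structure DecisionGraph where
  V : Type
  E : V → V → Prop
  root : V
  reach : ∀ w, Relation.ReflTransGen E root w
  dist_succ : ∀ v w, E v w → ddist E root w = ddist E root v + 1
  exists_out : ∀ v, ∃ w, E v w
  finite_out : ∀ v, {w | E v w}.Finite

namespace DecisionGraph

/-- `|w|`, the distance from the root. -/
noncomputable def level (D : DecisionGraph) (w : D.V) : ℕ := ddist D.E D.root w

theorem level_root (D : DecisionGraph) : D.level D.root = 0 := by
  have : (0 : ℕ) ∈ {n | HasPath D.E n D.root D.root} := ⟨fun _ => D.root, rfl, rfl, by simp⟩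
  exact Nat.le_zero.mp (Nat.sInf_le this)

theorem level_succ (D : DecisionGraph) {v w : D.V} (h : D.E v w) :
    D.level w = D.level v + 1 := D.dist_succ v w h

theorem eq_root_or_pred (D : DecisionGraph) (w : D.V) : w = D.root ∨ ∃ v, D.E v w := by
  rcases (D.reach w).cases_tail with h | ⟨v, _, h⟩
  · exact Or.inl h
  · exact Or.inr ⟨v, h⟩

theorem ddist_eq_of_level {V : Type} {E : V → V → Prop} {r : V} (ℓ : V → ℕ)
    (h0 : ℓ r = 0) (hs : ∀ v w, E v w → ℓ w = ℓ v + 1) {w : V}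
    (hw : Relation.ReflTransGen E r w) : ddist E r w = ℓ w := by
  have key : ∀ n w, HasPath E n r w → ℓ w = n := by
    rintro n w ⟨p, hp0, hpn, hp⟩
    have : ∀ k ≤ n, ℓ (p k) = k := by
      intro k
      induction k with
      | zero => intro _; rw [hp0, h0]
      | succ k ih =>
        intro hk
        rw [hs _ _ (hp k (by omega)), ih (by omega)]
    rw [← hpn, this n le_rfl]
  have hne : ∃ n, HasPath E n r w := by
    induction hw with
    | refl => exact ⟨0, fun _ => r, rfl, rfl, by simp⟩
    | @tail b c _ hbc ih =>
      obtain ⟨n, p, hp0, hpn, hp⟩ := ih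
      refine ⟨n + 1, fun k => if k ≤ n then p k else c, by simp [hp0], by simp, ?_⟩
      intro k hk
      rcases Nat.lt_succ_iff_lt_or_eq.mp hk with h | h
      · have h1 : k ≤ n := by omega
        have h2 : k + 1 ≤ n := by omega
        simpa [h1, h2] using hp k h
      · subst h
        simpa [hpn] using hbc
  exact (key _ _ (Nat.sInf_mem (s := {n | HasPath E n r w}) hne)).symm

theorem reach_of_level {V : Type} {E : V → V → Prop} {r : V} (ℓ : V → ℕ)
    (hs : ∀ v w, E v w → ℓ w = ℓ v + 1)
    (hp : ∀ w, w = r ∨ ∃ v, E v w) (w : V) : Relation.ReflTransGen E r w := by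
  induction hn : ℓ w generalizing w with
  | zero =>
    rcases hp w with rfl | ⟨v, hv⟩
    · exact Relation.ReflTransGen.refl
    · have := hs _ _ hv; omega
  | succ n ih =>
    rcases hp w with rfl | ⟨v, hv⟩
    · exact Relation.ReflTransGen.refl
    · exact (ih v (by have := hs _ _ hv; omega)).tail hv

/-- Builds a decision graph from its vertices, edges and root, when a function `ℓ` is known that is
zero in the root and increases by one along each edge; `ℓ` is then the distance from the root
(see `level_ofLevel`). -/
def ofLevel (V : Type) (E : V → V → Prop) (r : V) (ℓ : V → ℕ) (h0 : ℓ r = 0)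
    (hs : ∀ v w, E v w → ℓ w = ℓ v + 1) (hp : ∀ w, w = r ∨ ∃ v, E v w)
    (ho : ∀ v, ∃ w, E v w) (hf : ∀ v, {w | E v w}.Finite) : DecisionGraph where
  V := V
  E := E
  root := r
  reach := reach_of_level ℓ hs hp
  dist_succ v w h := by
    rw [ddist_eq_of_level ℓ h0 hs (reach_of_level ℓ hs hp w),
      ddist_eq_of_level ℓ h0 hs (reach_of_level ℓ hs hp v), hs v w h]
  exists_out := ho
  finite_out := hf

theorem level_ofLevel {V : Type} {E : V → V → Prop} {r : V} {ℓ : V → ℕ} (h0 : ℓ r = 0)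
    (hs : ∀ v w, E v w → ℓ w = ℓ v + 1) (hp : ∀ w, w = r ∨ ∃ v, E v w)
    (ho : ∀ v, ∃ w, E v w) (hf : ∀ v, {w | E v w}.Finite) (w : V) :
    (ofLevel V E r ℓ h0 hs hp ho hf).level w = ℓ w :=
  ddist_eq_of_level ℓ h0 hs (reach_of_level ℓ hs hp w)

theorem finite_level_le (D : DecisionGraph) (n : ℕ) : {w | D.level w ≤ n}.Finite := by
  induction n with
  | zero =>
    refine (Set.finite_singleton D.root).subset fun w hw => ?_
    rcases D.eq_root_or_pred w with h | ⟨v, h⟩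
    · exact h
    · have := D.level_succ h
      simp only [Set.mem_ofPred_eq] at hw
      omega
  | succ n ih =>
    refine ((Set.finite_singleton D.root).union
      (ih.biUnion fun v _ => D.finite_out v)).subset fun w hw => ?_
    rcases D.eq_root_or_pred w with h | ⟨v, h⟩
    · exact Or.inl h
    · have := D.level_succ h
      simp only [Set.mem_ofPred_eq] at hw
      refine Or.inr (Set.mem_biUnion (x := v) ?_ h)
      simp only [Set.mem_ofPred_eq]
      omega

/-- The game-graph with vertex set `[D]_n = {w : |w| ≤ n}` and the edges of `D` between them,
where the player `t |v|` has the turn in the non-final state `v`. -/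
noncomputable def truncate (D : DecisionGraph) (n : ℕ) (t : ℕ → Player) : GameGraph where
  V := {w : D.V // D.level w ≤ n}
  E v w := D.E v.1 w.1
  root := ⟨D.root, by rw [D.level_root]; exact Nat.zero_le n⟩
  finite := (D.finite_level_le n).to_subtype
  acyclic := by
    have h : ∀ v w : {w : D.V // D.level w ≤ n},
        Relation.TransGen (fun v w => D.E v.1 w.1) v w → D.level v.1 < D.level w.1 := by
      intro v w h
      induction h with
      | single h => rw [D.level_succ h]; omega
      | tail _ h ih => rw [D.level_succ h]; omega
    exact fun v hv => lt_irrefl _ (h v v hv)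
  reach := by
    refine reach_of_level (fun w : {w : D.V // D.level w ≤ n} => D.level w.1)
      (fun v w h => D.level_succ h) ?_
    rintro ⟨w, hw⟩
    rcases D.eq_root_or_pred w with h | ⟨v, h⟩
    · exact Or.inl (Subtype.ext h)
    · exact Or.inr ⟨⟨v, by have := D.level_succ h; omega⟩, h⟩
  turn v := t (D.level v.1.1)

/-- `G_n(D)`: Alice and Bob together play `n` moves in turns, and Alice starts. -/
noncomputable def aliceStarts (D : DecisionGraph) (n : ℕ) : GameGraph :=
  D.truncate n fun m => if Even m then Player.alice else Player.bob

/-- `G'_n(D)`: Alice and Bob together play `n` moves in turns, and Bob starts. -/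
noncomputable def bobStarts (D : DecisionGraph) (n : ℕ) : GameGraph :=
  D.truncate n fun m => if Even m then Player.bob else Player.alice

/-- The vertices of `D₁ ⋉ D₂`: the pairs `(a, b)` with `|a| = |b|` (these are the pairs at an even
distance from the root) or `|a| = |b| + 1` (those at an odd distance). -/
def IsLtimesVertex (D₁ D₂ : DecisionGraph) (p : D₁.V × D₂.V) : Prop :=
  D₁.level p.1 = D₂.level p.2 ∨ D₁.level p.1 = D₂.level p.2 + 1

/-- The edges of `D₁ ⋉ D₂`: from a vertex at an even distance from the root, the first coordinate
moves, and from a vertex at an odd distance, the second coordinate moves. -/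
def LtimesEdge (D₁ D₂ : DecisionGraph) (p q : D₁.V × D₂.V) : Prop :=
  (D₁.level p.1 = D₂.level p.2 ∧ D₁.E p.1 q.1 ∧ q.2 = p.2) ∨
    (D₁.level p.1 = D₂.level p.2 + 1 ∧ q.1 = p.1 ∧ D₂.E p.2 q.2)

theorem ltimesEdge_level {D₁ D₂ : DecisionGraph} {p q : D₁.V × D₂.V}
    (h : LtimesEdge D₁ D₂ p q) :
    D₁.level q.1 + D₂.level q.2 = D₁.level p.1 + D₂.level p.2 + 1 := by
  rcases h with ⟨_, h1, h2⟩ | ⟨_, h1, h2⟩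
  · rw [h2, D₁.level_succ h1]; omega
  · rw [h1, D₂.level_succ h2]; omega

theorem ltimes_pred {D₁ D₂ : DecisionGraph} (p : D₁.V × D₂.V) (hp : IsLtimesVertex D₁ D₂ p) :
    p = (D₁.root, D₂.root) ∨ ∃ q, IsLtimesVertex D₁ D₂ q ∧ LtimesEdge D₁ D₂ q p := by
  obtain ⟨a, b⟩ := p
  have r1 := D₁.level_root
  have r2 := D₂.level_root
  simp only [IsLtimesVertex] at hp
  rcases hp with hp | hp
  · rcases D₂.eq_root_or_pred b with hb | ⟨b', hb⟩
    · rcases D₁.eq_root_or_pred a with ha | ⟨a', ha⟩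
      · exact Or.inl (by rw [ha, hb])
      · have := D₁.level_succ ha
        rw [hb] at hp
        omega
    · have := D₂.level_succ hb
      exact Or.inr ⟨(a, b'), Or.inr (by simp only; omega),
        Or.inr ⟨by simp only; omega, rfl, hb⟩⟩
  · rcases D₁.eq_root_or_pred a with ha | ⟨a', ha⟩
    · rw [ha] at hp
      omega
    · have := D₁.level_succ ha
      exact Or.inr ⟨(a', b), Or.inl (by simp only; omega),
        Or.inl ⟨by simp only; omega, ha, rfl⟩⟩

theorem ltimes_out {D₁ D₂ : DecisionGraph} (p : D₁.V × D₂.V) (hp : IsLtimesVertex D₁ D₂ p) :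
    ∃ q, IsLtimesVertex D₁ D₂ q ∧ LtimesEdge D₁ D₂ p q := by
  obtain ⟨a, b⟩ := p
  simp only [IsLtimesVertex] at hp
  rcases hp with hp | hp
  · obtain ⟨a', ha⟩ := D₁.exists_out a
    have := D₁.level_succ ha
    exact ⟨(a', b), Or.inr (by simp only; omega), Or.inl ⟨hp, ha, rfl⟩⟩
  · obtain ⟨b', hb⟩ := D₂.exists_out b
    have := D₂.level_succ hb
    exact ⟨(a, b'), Or.inl (by simp only; omega), Or.inr ⟨hp, rfl, hb⟩⟩

theorem ltimes_finite {D₁ D₂ : DecisionGraph} (p : D₁.V × D₂.V) :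
    {q | LtimesEdge D₁ D₂ p q}.Finite := by
  refine (((D₁.finite_out p.1).prod (Set.finite_singleton p.2)).union
    ((Set.finite_singleton p.1).prod (D₂.finite_out p.2))).subset ?_
  rintro q (⟨_, h1, h2⟩ | ⟨_, h1, h2⟩)
  · exact Or.inl ⟨h1, h2⟩
  · exact Or.inr ⟨h1, h2⟩

/-- The decision graph `D₁ ⋉ D₂`. -/
noncomputable def ltimes (D₁ D₂ : DecisionGraph) : DecisionGraph :=
  ofLevel {p : D₁.V × D₂.V // IsLtimesVertex D₁ D₂ p} (fun p q => LtimesEdge D₁ D₂ p.1 q.1)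
    ⟨(D₁.root, D₂.root), Or.inl (by rw [D₁.level_root, D₂.level_root])⟩
    (fun p => D₁.level p.1.1 + D₂.level p.1.2)
    (by simp only [D₁.level_root, D₂.level_root])
    (fun _ _ h => ltimesEdge_level h)
    (fun p => by
      rcases ltimes_pred p.1 p.2 with h | ⟨q, hq, h⟩
      · exact Or.inl (Subtype.ext h)
      · exact Or.inr ⟨⟨q, hq⟩, h⟩)
    (fun p => by
      obtain ⟨q, hq, h⟩ := ltimes_out p.1 p.2
      exact ⟨⟨q, hq⟩, h⟩)
    (fun p => (ltimes_finite p.1).preimage Subtype.val_injective.injOn)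

/-- The decision graph `D₁ ⋊ D₂ = {(a, b) : (b, a) ∈ D₂ ⋉ D₁}`, with the edges and the root of
`D₂ ⋉ D₁`. -/
noncomputable def rtimes (D₁ D₂ : DecisionGraph) : DecisionGraph :=
  ofLevel {p : D₁.V × D₂.V // IsLtimesVertex D₂ D₁ p.swap}
    (fun p q => LtimesEdge D₂ D₁ p.1.swap q.1.swap)
    ⟨(D₁.root, D₂.root), Or.inl (by simp only [Prod.swap, D₁.level_root, D₂.level_root])⟩
    (fun p => D₂.level p.1.2 + D₁.level p.1.1)
    (by simp only [D₁.level_root, D₂.level_root])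
    (fun _ _ h => ltimesEdge_level h)
    (fun p => by
      rcases ltimes_pred p.1.swap p.2 with h | ⟨q, hq, h⟩
      · exact Or.inl (Subtype.ext (Prod.swap_injective h))
      · exact Or.inr ⟨⟨q.swap, by simpa using hq⟩, by simpa using h⟩)
    (fun p => by
      obtain ⟨q, hq, h⟩ := ltimes_out p.1.swap p.2
      exact ⟨⟨q.swap, by simpa using hq⟩, by simpa using h⟩)
    (fun p => (ltimes_finite p.1.swap).preimage
      (Prod.swap_injective.comp Subtype.val_injective).injOn)

end DecisionGraph

/-! ### The binary tree and the quadrant -/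

/-- The alphabet `{1, 2}`. -/
inductive Letter
  | one
  | two

instance : Finite Letter :=
  Finite.of_injective (fun k : Letter => match k with
    | Letter.one => (0 : Fin 2)
    | Letter.two => 1) (by rintro (_ | _) (_ | _) h <;> simp_all)

/-- A decision graph in which the edges out of a vertex `v` lead to the two vertices
`v1 = move v one` and `v2 = move v two`. -/
structure BinaryDecisionGraph extends DecisionGraph where
  move : V → Letter → V
  edge_iff : ∀ v w, E v w ↔ ∃ k, w = move v k

/-- The binary tree `𝕋` of finite words over `{1, 2}`; `move` appends a letter. -/
def tree : BinaryDecisionGraph where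
  toDecisionGraph := DecisionGraph.ofLevel (List Letter) (fun v w => ∃ k, w = v ++ [k]) []
    List.length rfl
    (by rintro v w ⟨k, rfl⟩; simp)
    (fun w => by
      rcases List.eq_nil_or_concat w with h | ⟨v, k, h⟩
      · exact Or.inl h
      · exact Or.inr ⟨v, k, by simpa using h⟩)
    (fun v => ⟨_, Letter.one, rfl⟩)
    (fun v => (Set.finite_range fun k : Letter => v ++ [k]).subset
      (by rintro w ⟨k, rfl⟩; exact ⟨k, rfl⟩))
  move := fun (v : List Letter) (k : Letter) => v ++ [k]
  edge_iff _ _ := Iff.rfl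

/-- The moves in the quadrant: `(i, j)1 = (i + 1, j)` and `(i, j)2 = (i, j + 1)`. -/
def quadrantMove (v : ℕ × ℕ) : Letter → ℕ × ℕ
  | Letter.one => (v.1 + 1, v.2)
  | Letter.two => (v.1, v.2 + 1)

/-- The quadrant `ℕ²` with edges from `(i, j)` to `(i + 1, j)` and `(i, j + 1)`. -/
def quadrant : BinaryDecisionGraph where
  toDecisionGraph := DecisionGraph.ofLevel (ℕ × ℕ) (fun v w => ∃ k, w = quadrantMove v k) (0, 0)
    (fun v => v.1 + v.2) rfl
    (by rintro v w ⟨_ | _, rfl⟩ <;> simp only [quadrantMove] <;> omega)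
    (by
      rintro ⟨_ | i, j⟩
      · rcases j with _ | j
        · exact Or.inl rfl
        · exact Or.inr ⟨(0, j), Letter.two, rfl⟩
      · exact Or.inr ⟨(i, j), Letter.one, rfl⟩)
    (fun v => ⟨_, Letter.one, rfl⟩)
    (fun v => (Set.finite_range (quadrantMove v)).subset
      (by rintro w ⟨k, rfl⟩; exact ⟨k, rfl⟩))
  move := quadrantMove
  edge_iff _ _ := Iff.rfl

/-! ### Games on products, and Toom cycles -/

/-- A game-graph whose states are pairs `(a, b)` of a vertex `a` of a decision graph of Alice and a
vertex `b` of a decision graph of Bob; `coord` sends a state to this pair. -/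
structure PairGame extends GameGraph where
  A : BinaryDecisionGraph
  B : BinaryDecisionGraph
  coord : V → A.V × B.V
  coord_injective : Function.Injective coord

/-- The game-graph `G_n(A ⋉ B)`. -/
noncomputable def ltimesGame (A B : BinaryDecisionGraph) (n : ℕ) : PairGame where
  toGameGraph := (A.toDecisionGraph.ltimes B.toDecisionGraph).aliceStarts n
  A := A
  B := B
  coord v := v.1.1
  coord_injective _ _ h := Subtype.ext (Subtype.ext h)

/-- The game-graph `G'_n(A ⋊ B)`. -/
noncomputable def rtimesGame (A B : BinaryDecisionGraph) (n : ℕ) : PairGame where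
  toGameGraph := (A.toDecisionGraph.rtimes B.toDecisionGraph).bobStarts n
  A := A
  B := B
  coord v := v.1.1
  coord_injective _ _ h := Subtype.ext (Subtype.ext h)

/-- The six types of steps: straight, left, right, each up or down. -/
inductive StepType
  | su
  | sd
  | lu
  | ld
  | ru
  | rd

/-- The combinations of types of two consecutive steps that are allowed in an internal vertex. -/
inductive InteriorRule : StepType → StepType → Prop
  | su_ru : InteriorRule StepType.su StepType.ru
  | ru_su : InteriorRule StepType.ru StepType.su
  | lu_su : InteriorRule StepType.lu StepType.su
  | sd_rd : InteriorRule StepType.sd StepType.rd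
  | sd_ld : InteriorRule StepType.sd StepType.ld
  | rd_sd : InteriorRule StepType.rd StepType.sd
  | ld_lu : InteriorRule StepType.ld StepType.lu

/-- The combinations of types of two consecutive steps that are allowed in a possible outcome. -/
inductive BoundaryRule : StepType → StepType → Prop
  | su_sd : BoundaryRule StepType.su StepType.sd
  | ru_rd : BoundaryRule StepType.ru StepType.rd
  | ru_ld : BoundaryRule StepType.ru StepType.ld
  | lu_rd : BoundaryRule StepType.lu StepType.rd
  | lu_ld : BoundaryRule StepType.lu StepType.ld

namespace PairGame

variable (G : PairGame)

/-- The edges from `(a, b)` to `(ak, b)`, where `(a, b)` is a state in which Alice moves. -/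
def AEdge (k : Letter) (v w : G.V) : Prop :=
  G.IsTurn Player.alice v ∧ G.coord w = (G.A.move (G.coord v).1 k, (G.coord v).2)

/-- The edges from `(a, b)` to `(a, bk)`, where `(a, b)` is a state in which Bob moves. -/
def BEdge (k : Letter) (v w : G.V) : Prop :=
  G.IsTurn Player.bob v ∧ G.coord w = ((G.coord v).1, G.B.move (G.coord v).2 k)

/-- The step from `v` to `w` is of the given type. -/
def IsStep : StepType → G.V → G.V → Prop
  | StepType.su, v, w => ∃ k, G.AEdge k v w
  | StepType.sd, v, w => ∃ k, G.AEdge k w v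
  | StepType.lu, v, w => G.BEdge Letter.two v w
  | StepType.ld, v, w => G.BEdge Letter.one w v
  | StepType.ru, v, w => G.BEdge Letter.one v w
  | StepType.rd, v, w => G.BEdge Letter.two w v

def IsUp (v w : G.V) : Prop :=
  G.IsStep StepType.su v w ∨ G.IsStep StepType.lu v w ∨ G.IsStep StepType.ru v w

def IsDown (v w : G.V) : Prop :=
  G.IsStep StepType.sd v w ∨ G.IsStep StepType.ld v w ∨ G.IsStep StepType.rd v w

/-- `ψ 0, …, ψ l` is a walk of length `l` in `G`: each step follows an edge or a reversed edge.
The values `ψ k` with `k > l` are irrelevant, here and below. -/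
def IsWalk (l : ℕ) (ψ : ℕ → G.V) : Prop :=
  ∀ k < l, G.E (ψ k) (ψ (k + 1)) ∨ G.E (ψ (k + 1)) (ψ k)

/-- `N_↑`. -/
def NUp (l : ℕ) (ψ : ℕ → G.V) : Set ℕ :=
  {k | 0 < k ∧ k < l ∧ G.IsUp (ψ (k - 1)) (ψ k) ∧ G.IsUp (ψ k) (ψ (k + 1))} ∪ {0}

/-- `N_∘`. -/
def NCirc (l : ℕ) (ψ : ℕ → G.V) : Set ℕ :=
  {k | 0 < k ∧ k < l ∧ G.IsDown (ψ (k - 1)) (ψ k) ∧ G.IsUp (ψ k) (ψ (k + 1))}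

/-- `N_↓`. -/
def NDown (l : ℕ) (ψ : ℕ → G.V) : Set ℕ :=
  {k | 0 < k ∧ k < l ∧ G.IsDown (ψ (k - 1)) (ψ k) ∧ G.IsDown (ψ k) (ψ (k + 1))} ∪ {l}

/-- `N_∗`. -/
def NStar (l : ℕ) (ψ : ℕ → G.V) : Set ℕ :=
  {k | 0 < k ∧ k < l ∧ G.IsUp (ψ (k - 1)) (ψ k) ∧ G.IsDown (ψ k) (ψ (k + 1))}

/-- The sets `N_↑, N_∘, N_↓`, in the order `↑ < ∘ < ↓`. -/
def NSet (l : ℕ) (ψ : ℕ → G.V) : Fin 3 → Set ℕ := ![G.NUp l ψ, G.NCirc l ψ, G.NDown l ψ]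

/-- `ψ 0, …, ψ l` is a Toom cycle in `G`. -/
structure IsToomCycle (l : ℕ) (ψ : ℕ → G.V) : Prop where
  two_le : 2 ≤ l
  walk : G.IsWalk l ψ
  start : ψ 0 = G.root
  finish : ψ l = G.root
  first_step : G.IsStep StepType.su (ψ 0) (ψ 1) ∨ G.IsStep StepType.ru (ψ 0) (ψ 1)
  last_step : G.IsStep StepType.sd (ψ (l - 1)) (ψ l) ∨ G.IsStep StepType.rd (ψ (l - 1)) (ψ l)
  interior_rule : ∀ k, 0 < k → k < l → (∃ w, G.E (ψ k) w) →
    ∃ s t, G.IsStep s (ψ (k - 1)) (ψ k) ∧ G.IsStep t (ψ k) (ψ (k + 1)) ∧ InteriorRule s t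
  boundary_rule : ∀ k, 0 < k → k < l → (¬ ∃ w, G.E (ψ k) w) →
    ∃ s t, G.IsStep s (ψ (k - 1)) (ψ k) ∧ G.IsStep t (ψ k) (ψ (k + 1)) ∧ BoundaryRule s t
  star_injective : ∀ k ∈ G.NStar l ψ, ∀ m ∈ G.NStar l ψ, k ≠ m → ψ k ≠ ψ m
  ordered : ∀ s t : Fin 3, s ≤ t → ∀ k ∈ G.NSet l ψ s, ∀ m ∈ G.NSet l ψ t, ψ k = ψ m → k ≤ m

/-- `ψ 0, …, ψ l` visits only possible outcomes that are a win for Alice. -/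
def IsPresent (x : G.Boundary → Fin 2) (l : ℕ) (ψ : ℕ → G.V) : Prop :=
  ∀ k ≤ l, ∀ h : ¬ ∃ w, G.E (ψ k) w, x ⟨ψ k, h⟩ = 0

end PairGame

end MinimaxGame

namespace MinimaxGame

/-! Fix a winning strategy of Alice and call a state safe if this strategy wins from there against
every strategy of Bob. Safety is preserved by the prescribed moves of Alice and by all moves of Bob,
and a safe outcome is a win for Alice. It remains to build a Toom cycle through safe states only.

The cycle is grown level by level. At depth 0 it is the trivial walk at the root. To pass from depth
`m` to `m + 1`, each visit to an outermost vertex `v` is replaced by an excursion: if Alice moves at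
`v`, go straight-up along her prescribed edge and back; if Bob moves, explore both of his edges, by
right-up, left-down, left-up, right-down. The excursion of Alice splits an up–down visit into an
up–up and a down–down visit, that of Bob into up–up, down–up and down–down visits, in this order.

Different excursions may reach the same new vertex. Before the next extension, the loops between
such visits are therefore cut out, so that each outermost vertex is visited at most once. Hence all
later visits to a vertex come from a single excursion at that vertex, and condition (ii) holds: it
says that `Visit.rank` strictly increases along the visits to an internal vertex. At depth `n` the
up–down visits are visits to outcomes, and the cutting of loops gives condition (i).

The steps are `IsCycle.exists_succ` (extension), `IsCycle.exists_simple` (cutting) and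
`exists_isToomCycle` (translation into the definition); `AlternatingGame.guarded` supplies the safe
states. Only the alternation of turns and the two edges of Bob matter, so all four graphs are
treated alike. -/

theorem exists_of_not_pairwise {α : Type*} {R : α → α → Prop} {L : List α} (h : ¬ L.Pairwise R) :
    ∃ L₁ a L₂ b L₃, L = L₁ ++ a :: (L₂ ++ b :: L₃) ∧ ¬ R a b := by
  induction L with
  | nil => simp at h
  | cons c L ih =>
    by_cases hL : L.Pairwise R
    · simp only [List.pairwise_cons, hL, and_true, not_forall] at h
      obtain ⟨b, hb, hR⟩ := h
      obtain ⟨L₂, L₃, rfl⟩ := List.append_of_mem hb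
      exact ⟨[], c, L₂, b, L₃, rfl, hR⟩
    · obtain ⟨L₁, a, L₂, b, L₃, rfl, hR⟩ := ih hL
      exact ⟨c :: L₁, a, L₂, b, L₃, rfl, hR⟩

/-! ### Visits, their rules and guarded games. -/

/-- The steps that go down. -/
def StepType.IsDown : StepType → Prop
  | sd | ld | rd => True
  | su | lu | ru => False

/-- A visit of a walk to a vertex, together with the types of the preceding and of the next step,
where `none` means that there is no such step. -/
structure Visit (V : Type) where
  vertex : V
  inc : Option StepType
  out : Option StepType

open Classical in
/-- The position of the visit in the order `↑ < ∘ < ↓`, if it is not an up-down visit. -/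
noncomputable def Visit.rank {V : Type} (a : Visit V) : ℕ :=
  (if ∃ s, a.inc = some s ∧ s.IsDown then 1 else 0) +
    (if ∀ s, a.out = some s → s.IsDown then 1 else 0)

/-- The rule for visits to internal vertices, including the first and the last visit. -/
inductive InnerRule : Option StepType → Option StepType → Prop
  | start_su : InnerRule none (some StepType.su)
  | start_ru : InnerRule none (some StepType.ru)
  | finish_sd : InnerRule (some StepType.sd) none
  | finish_rd : InnerRule (some StepType.rd) none
  | inner {s t : StepType} : InteriorRule s t → InnerRule (some s) (some t)

/-- The rule for visits to the outermost vertices, where the given player would be next to move. -/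
inductive OuterRule : Player → Option StepType → Option StepType → Prop
  | trivial (p : Player) : OuterRule p none none
  | su_sd : OuterRule Player.bob (some StepType.su) (some StepType.sd)
  | ru_rd : OuterRule Player.alice (some StepType.ru) (some StepType.rd)
  | ru_ld : OuterRule Player.alice (some StepType.ru) (some StepType.ld)
  | lu_rd : OuterRule Player.alice (some StepType.lu) (some StepType.rd)
  | lu_ld : OuterRule Player.alice (some StepType.lu) (some StepType.ld)

/-- For each player the nontrivial combinations form a full product: {su} × {sd}, or {ru, lu} × {rd,
ld}. Hence the entry of one visit may be combined with the exit of another; this is what makes loop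
erasure legitimate. -/
theorem OuterRule.join {p : Player} {s t s' t' : Option StepType} (h : OuterRule p s t)
    (h' : OuterRule p s' t') (hs : s' ≠ none) (ht : t ≠ none) : OuterRule p s t' := by
  cases h <;> cases h' <;> first | exact absurd rfl hs | exact absurd rfl ht | constructor

theorem OuterRule.boundaryRule {p : Player} {s t : StepType} (h : OuterRule p (some s) (some t)) :
    BoundaryRule s t := by
  cases h <;> constructor

/-- Two consecutive visits of a walk. -/
def PairGame.Linked (G : PairGame) (a b : Visit G.V) : Prop :=
  ∃ s, a.out = some s ∧ b.inc = some s ∧ G.IsStep s a.vertex b.vertex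

/-- A game-graph of depth `n` that is graded by the distance to the root, in which the players take
turns, with a set of safe states that contains the root and that Alice, using `aliceMove`, can
prevent the play from leaving. -/
structure GuardedGame (G : PairGame) (n : ℕ) where
  level : G.V → ℕ
  turn : ℕ → Player
  turn_succ : ∀ m, turn (m + 1) = Player.alice ↔ turn m = Player.bob
  level_root : level G.root = 0
  level_up : ∀ v w, G.IsUp v w → level w = level v + 1
  edge_of_up : ∀ v w, G.IsUp v w → G.E v w
  interior_iff : ∀ v, (∃ w, G.E v w) ↔ level v < n
  safe : G.V → Prop
  safe_root : safe G.root
  aliceMove : G.V → G.V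
  aliceMove_spec : ∀ v, safe v → level v < n → turn (level v) = Player.alice →
    G.IsStep StepType.su v (aliceMove v) ∧ safe (aliceMove v)
  bobMove : Letter → G.V → G.V
  bobMove_spec : ∀ v, safe v → level v < n → turn (level v) = Player.bob → ∀ k,
    G.BEdge k v (bobMove k v) ∧ safe (bobMove k v)

/-! ### Erasing loops at the outermost level. -/

namespace GuardedGame

variable {G : PairGame} {n : ℕ} (g : GuardedGame G n)

/-- The list of visits of a closed walk that satisfies the conditions on a Toom cycle in the part of
the graph up to level `m`, except that outermost vertices may be visited more than once. -/
structure IsCycle (m : ℕ) (L : List (Visit G.V)) : Prop where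
  chain : L.IsChain G.Linked
  head : L.head?.map (fun a => (a.vertex, a.inc)) = some (G.root, none)
  last : L.getLast?.map (fun a => (a.vertex, a.out)) = some (G.root, none)
  safe : ∀ a ∈ L, g.safe a.vertex
  rule : ∀ a ∈ L, (g.level a.vertex < m ∧ InnerRule a.inc a.out) ∨
    (g.level a.vertex = m ∧ OuterRule (g.turn m) a.inc a.out)
  order : L.Pairwise fun a b => a.vertex = b.vertex → g.level a.vertex < m → a.rank < b.rank

/-- The outermost vertices are visited at most once. -/
def IsSimple (m : ℕ) (L : List (Visit G.V)) : Prop :=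
  L.Pairwise fun a b => a.vertex = b.vertex → g.level a.vertex ≠ m

variable {g}

/-- Two visits `a`, `b` to the same outermost vertex are merged into one, with the entry of `a` and
the exit of `b`, and everything between them is dropped. The order condition survives because the
other visits form a sublist and the merged visit, being outermost, is exempt from it. -/
theorem IsCycle.exists_shorter {m : ℕ} {L : List (Visit G.V)} (h : g.IsCycle m L)
    (hs : ¬ g.IsSimple m L) : ∃ L', g.IsCycle m L' ∧ L'.length < L.length := by
  obtain ⟨L₁, a, L₂, b, L₃, rfl, hab⟩ := exists_of_not_pairwise hs
  push Not at hab
  obtain ⟨hv, hl⟩ := hab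
  have ha : a ∈ L₁ ++ a :: (L₂ ++ b :: L₃) := by simp
  have hb : b ∈ L₁ ++ a :: (L₂ ++ b :: L₃) := by simp
  have hra := (h.rule a ha).resolve_left fun h => by omega
  have hrb := (h.rule b hb).resolve_left fun h => by rw [← hv] at h; omega
  have hsub : (L₁ ++ L₃).Sublist (L₁ ++ a :: (L₂ ++ b :: L₃)) :=
    List.Sublist.append_left (((List.sublist_cons_self b L₃).trans
      (List.sublist_append_right L₂ _)).trans (List.sublist_cons_self a _)) L₁
  have hmem : ∀ c ∈ L₁ ++ ⟨a.vertex, a.inc, b.out⟩ :: L₃, c = ⟨a.vertex, a.inc, b.out⟩ ∨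
      c ∈ L₁ ++ a :: (L₂ ++ b :: L₃) := by
    intro c hc
    simp only [List.mem_append, List.mem_cons] at hc ⊢
    tauto
  obtain ⟨hc1, hc2⟩ := List.isChain_split.1 h.chain
  obtain ⟨hc3, hc4⟩ := List.isChain_cons_split.1 hc2
  refine ⟨L₁ ++ ⟨a.vertex, a.inc, b.out⟩ :: L₃, ⟨?_, ?_, ?_, ?_, ?_, ?_⟩, ?_⟩
  · refine List.isChain_split.2 ⟨?_, ?_⟩
    · rw [List.isChain_append] at hc1 ⊢
      simpa [PairGame.Linked] using hc1
    · rw [List.isChain_cons] at hc4 ⊢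
      simpa [PairGame.Linked, hv] using hc4
  · have := h.head
    cases L₁ <;> simpa using this
  · have := h.last
    rcases List.eq_nil_or_concat L₃ with rfl | ⟨L, c, rfl⟩
    · simpa [List.getLast?_append, List.getLast?_cons, hv] using this
    · simpa [List.getLast?_append, List.getLast?_cons] using this
  · intro c hc
    rcases hmem c hc with rfl | hc
    · exact h.safe a ha
    · exact h.safe c hc
  · intro c hc
    rcases hmem c hc with rfl | hc
    -- The side conditions of `join` hold since `b` has a predecessor and `a` a successor in the
    -- list.
    · refine Or.inr ⟨hl, hra.2.join hrb.2 ?_ ?_⟩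
      · obtain ⟨L, c, hL⟩ : ∃ L c, a :: L₂ = L ++ [c] := by
          rcases List.eq_nil_or_concat (a :: L₂) with h | ⟨L, c, h⟩
          · simp at h
          · exact ⟨L, c, by simpa using h⟩
        have h' : (L ++ [c] ++ [b]).IsChain G.Linked := by rw [← hL]; simpa using hc3
        obtain ⟨s, -, hs, -⟩ := (List.isChain_append.1 h').2.2 c (by simp) b (by simp)
        simp [hs]
      · cases L₂ with
        | nil =>
          obtain ⟨s, hs, -⟩ := (List.isChain_cons.1 hc3).1 b (by simp)
          simp [hs]
        | cons c L =>
          obtain ⟨s, hs, -⟩ := (List.isChain_cons.1 hc3).1 c (by simp)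
          simp [hs]
    · exact h.rule c hc
  · have h1 := h.order.sublist hsub
    rw [List.pairwise_append] at h1 ⊢
    have h2 := List.pairwise_append.1 h.order
    refine ⟨h1.1, List.pairwise_cons.2 ⟨?_, h1.2.1⟩, ?_⟩
    · intro c hc _ hlt
      exact absurd hl hlt.ne
    · intro c hc d hd
      rcases List.mem_cons.1 hd with rfl | hd
      · intro hcd hlt
        rw [hcd] at hlt
        exact absurd hl hlt.ne
      · exact h1.2.2 c hc d hd
  · simp only [List.length_append, List.length_cons]
    omega

theorem IsCycle.exists_simple {m : ℕ} {L : List (Visit G.V)} (h : g.IsCycle m L) :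
    ∃ L', g.IsCycle m L' ∧ g.IsSimple m L' := by
  induction hk : L.length using Nat.strong_induction_on generalizing L with
  | _ k ih =>
    by_cases hs : g.IsSimple m L
    · exact ⟨L, h, hs⟩
    · obtain ⟨L', h', hlt⟩ := h.exists_shorter hs
      exact ih _ (hk ▸ hlt) h' rfl

/-! ### Extending the cycle by one level. -/

variable (g) in
/-- The list `l` of visits may replace the visit `a` when the part of the graph up to level `m` is
extended by one level. -/
structure Refines (m : ℕ) (a : Visit G.V) (l : List (Visit G.V)) : Prop where
  chain : l.IsChain G.Linked
  head : l.head?.map (fun a => (a.vertex, a.inc)) = some (a.vertex, a.inc)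
  last : l.getLast?.map (fun a => (a.vertex, a.out)) = some (a.vertex, a.out)
  safe : ∀ b ∈ l, g.safe b.vertex
  rule : ∀ b ∈ l, (b.vertex = a.vertex ∧ g.level a.vertex < m + 1 ∧ InnerRule b.inc b.out) ∨
    (g.level b.vertex = m + 1 ∧ OuterRule (g.turn (m + 1)) b.inc b.out)
  order : l.Pairwise fun a b => a.vertex = b.vertex → g.level a.vertex < m + 1 → a.rank < b.rank
  eq_of_lt : g.level a.vertex < m → l = [a]

/-- The excursion goes along Alice's safe move and back. Bob made the preceding move, so `a` was
entered by ru or lu and left by rd or ld (or is the trivial visit); after splitting, both visits to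
the vertex obey the inner rules, with ranks 0 and 2. -/
theorem Refines.of_alice {m : ℕ} {a : Visit G.V} (hs : g.safe a.vertex)
    (hm : g.level a.vertex = m) (hmn : m < n) (ht : g.turn m = Player.alice)
    (hr : OuterRule (g.turn m) a.inc a.out) : ∃ l, g.Refines m a l := by
  subst hm
  obtain ⟨hstep, hsafe⟩ := g.aliceMove_spec _ hs hmn ht
  have hlev := g.level_up _ _ (Or.inl hstep)
  have hturn : g.turn (g.level a.vertex + 1) = Player.bob := by
    have := g.turn_succ (g.level a.vertex)
    cases h : g.turn (g.level a.vertex + 1) <;> simp_all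
  obtain ⟨v, s, t⟩ := a
  refine ⟨[⟨v, s, some .su⟩, ⟨g.aliceMove v, some .su, some .sd⟩, ⟨v, some .sd, t⟩],
    ?_, rfl, rfl, ?_, ?_, ?_, fun h => absurd h (lt_irrefl _)⟩
  · simp only [List.isChain_cons_cons, List.isChain_singleton, and_true]
    exact ⟨⟨_, rfl, rfl, hstep⟩, ⟨_, rfl, rfl, hstep⟩⟩
  · simp only [List.mem_cons, List.not_mem_nil, or_false, forall_eq_or_imp, forall_eq]
    exact ⟨hs, hsafe, hs⟩
  · simp only [ht] at hr
    simp only [List.mem_cons, List.not_mem_nil, or_false, forall_eq_or_imp, forall_eq]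
    refine ⟨Or.inl ⟨trivial, by simp, ?_⟩, Or.inr ⟨hlev, ?_⟩, Or.inl ⟨trivial, by simp, ?_⟩⟩
    · cases hr <;> constructor <;> constructor
    · rw [hturn]; constructor
    · cases hr <;> constructor <;> constructor
  · simp only [ht] at hr
    simp only [List.pairwise_cons, List.mem_cons, List.not_mem_nil, or_false, forall_eq_or_imp,
      forall_eq, hlev]
    simp only at hlev hr
    cases hr <;> simp [Visit.rank, StepType.IsDown]

/-- The excursion visits both successors, each of which is safe whatever Bob does. The three visits
to the old vertex have ranks 0, 1 and 2, the middle one being the combination ld→lu. -/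
theorem Refines.of_bob {m : ℕ} {a : Visit G.V} (hs : g.safe a.vertex)
    (hm : g.level a.vertex = m) (hmn : m < n) (ht : g.turn m = Player.bob)
    (hr : OuterRule (g.turn m) a.inc a.out) : ∃ l, g.Refines m a l := by
  subst hm
  obtain ⟨hstep₁, hsafe₁⟩ := g.bobMove_spec _ hs hmn ht Letter.one
  obtain ⟨hstep₂, hsafe₂⟩ := g.bobMove_spec _ hs hmn ht Letter.two
  have hlev₁ := g.level_up _ _ (Or.inr (Or.inr hstep₁))
  have hlev₂ := g.level_up _ _ (Or.inr (Or.inl hstep₂))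
  have hturn : g.turn (g.level a.vertex + 1) = Player.alice := (g.turn_succ _).2 ht
  -- Needed because the middle visit to the old vertex and the following visit to the second
  -- successor both have rank 1.
  have hne : a.vertex ≠ g.bobMove .two a.vertex := fun h => by
    rw [← h] at hlev₂
    omega
  obtain ⟨v, s, t⟩ := a
  refine ⟨[⟨v, s, some .ru⟩, ⟨g.bobMove .one v, some .ru, some .ld⟩, ⟨v, some .ld, some .lu⟩,
    ⟨g.bobMove .two v, some .lu, some .rd⟩, ⟨v, some .rd, t⟩],
    ?_, rfl, rfl, ?_, ?_, ?_, fun h => absurd h (lt_irrefl _)⟩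
  · simp only [List.isChain_cons_cons, List.isChain_singleton, and_true]
    exact ⟨⟨_, rfl, rfl, hstep₁⟩, ⟨_, rfl, rfl, hstep₁⟩, ⟨_, rfl, rfl, hstep₂⟩,
      ⟨_, rfl, rfl, hstep₂⟩⟩
  · simp only [List.mem_cons, List.not_mem_nil, or_false, forall_eq_or_imp, forall_eq]
    exact ⟨hs, hsafe₁, hs, hsafe₂, hs⟩
  · simp only [ht] at hr
    simp only [List.mem_cons, List.not_mem_nil, or_false, forall_eq_or_imp, forall_eq]
    refine ⟨Or.inl ⟨trivial, by simp, ?_⟩, Or.inr ⟨hlev₁, ?_⟩, Or.inl ⟨trivial, by simp, .inner .ld_lu⟩,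
      Or.inr ⟨hlev₂, ?_⟩, Or.inl ⟨trivial, by simp, ?_⟩⟩
    · cases hr <;> constructor
      constructor
    · rw [hturn]; constructor
    · rw [hturn]; constructor
    · cases hr <;> constructor
      constructor
  · simp only [ht] at hr
    simp only [List.pairwise_cons, List.mem_cons, List.not_mem_nil, or_false, forall_eq_or_imp,
      forall_eq, hlev₁, hlev₂]
    simp only at hlev₁ hlev₂ hr hne
    cases hr <;> simp [hne, Visit.rank, StepType.IsDown]

theorem IsCycle.exists_refines {m : ℕ} {L : List (Visit G.V)} (h : g.IsCycle m L) (hmn : m < n)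
    {a : Visit G.V} (ha : a ∈ L) : ∃ l, g.Refines m a l := by
  have hs := h.safe a ha
  rcases h.rule a ha with ⟨hl, hr⟩ | ⟨hl, hr⟩
  · exact ⟨[a], by simp, rfl, rfl, by simpa, by simpa using Or.inl ⟨by omega, hr⟩, by simp,
      fun _ => rfl⟩
  · cases ht : g.turn m
    · exact Refines.of_alice hs hl hmn ht hr
    · exact Refines.of_bob hs hl hmn ht hr

/-- Replacing every visit by its refinement keeps the entries and exits, so consecutive blocks still
link up. Simplicity of the old cycle is what saves the order condition: two different blocks share a
vertex of level at most `m` only if that vertex has level less than `m`. -/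
theorem IsCycle.exists_succ {m : ℕ} {L : List (Visit G.V)} (h : g.IsCycle m L)
    (hs : g.IsSimple m L) (hmn : m < n) : ∃ L', g.IsCycle (m + 1) L' := by
  classical
  have hex : ∀ a, ∃ l, a ∈ L → g.Refines m a l := fun a => by
    by_cases ha : a ∈ L
    · obtain ⟨l, hl⟩ := h.exists_refines hmn ha
      exact ⟨l, fun _ => hl⟩
    · exact ⟨[], fun h => absurd h ha⟩
  choose f hf using hex
  refine ⟨L.flatMap f, ?_, ?_, ?_, ?_, ?_, ?_⟩
  · rw [List.flatMap_def, List.isChain_flatten]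
    · refine ⟨?_, ?_⟩
      · simp only [List.mem_map]
        rintro _ ⟨a, ha, rfl⟩
        exact (hf a ha).chain
      · rw [List.isChain_map]
        refine List.IsChain.imp_of_mem_imp ?_ h.chain
        rintro a b ha hb ⟨s, hsa, hsb, hstep⟩ x hx y hy
        have h1 := (hf a ha).last
        have h2 := (hf b hb).head
        rw [Option.mem_def.1 hx] at h1
        rw [Option.mem_def.1 hy] at h2
        simp only [Option.map_some, Option.some.injEq, Prod.mk.injEq] at h1 h2
        exact ⟨s, h1.2.trans hsa, h2.2.trans hsb, by rwa [h1.1, h2.1]⟩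
    · intro hnil
      obtain ⟨a, ha, hnil⟩ := List.mem_map.1 hnil
      have := (hf a ha).head
      simp [hnil] at this
  · cases L with
    | nil => simpa using h.head
    | cons a L =>
      have h1 := (hf a (by simp)).head
      have h2 := h.head
      cases hfa : f a with
      | nil => simp [hfa] at h1
      | cons b l =>
        simp only [hfa, List.head?_cons, Option.map_some] at h1 h2
        simp [hfa, h1.symm ▸ h2]
  · rcases List.eq_nil_or_concat L with rfl | ⟨L, a, rfl⟩
    · simpa using h.last
    · have h1 := (hf a (by simp)).last
      have h2 := h.last
      rcases List.eq_nil_or_concat (f a) with hfa | ⟨l, b, hfa⟩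
      · simp [hfa] at h1
      · simp [hfa] at h1 h2 ⊢
        simp_all
  · intro b hb
    obtain ⟨a, ha, hb⟩ := List.mem_flatMap.1 hb
    exact (hf a ha).safe b hb
  · intro b hb
    obtain ⟨a, ha, hb⟩ := List.mem_flatMap.1 hb
    rcases (hf a ha).rule b hb with ⟨h1, h2, h3⟩ | h1
    · exact Or.inl ⟨h1 ▸ h2, h3⟩
    · exact Or.inr h1
  · rw [List.pairwise_flatMap]
    refine ⟨fun a ha => (hf a ha).order, ?_⟩
    refine List.Pairwise.imp_of_mem ?_ (h.order.and hs)
    rintro a b ha hb ⟨ho, hsab⟩ x hx y hy hxy hlt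
    have hxa := ((hf a ha).rule x hx).resolve_right fun h => by omega
    have hyb := ((hf b hb).rule y hy).resolve_right fun h => by rw [hxy] at hlt; omega
    have hab : a.vertex = b.vertex := hxa.1.symm.trans (hxy.trans hyb.1)
    have hlev : g.level a.vertex < m := by have := hsab hab; omega
    -- Below level `m` the blocks are the old visits themselves, so the old order applies.
    rw [(hf a ha).eq_of_lt hlev] at hx
    rw [(hf b hb).eq_of_lt (hab ▸ hlev)] at hy
    rw [List.mem_singleton.1 hx, List.mem_singleton.1 hy]
    exact ho hab hlev

variable (g) in
-- The induction starts with a single visit to the root, without any step; this is the purpose of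
-- `OuterRule.trivial`.
theorem exists_isCycle : ∀ m ≤ n, ∃ L, g.IsCycle m L ∧ g.IsSimple m L
  | 0, _ => ⟨[⟨G.root, none, none⟩], ⟨by simp, rfl, rfl, by simpa using g.safe_root,
      by simpa [g.level_root] using OuterRule.trivial _, by simp⟩, by simp [IsSimple]⟩
  | m + 1, hm => by
    obtain ⟨L, hL, hs⟩ := exists_isCycle m (by omega)
    obtain ⟨L', hL'⟩ := hL.exists_succ hs (by omega)
    exact hL'.exists_simple

end GuardedGame

/-! ### The Toom cycle of a guarded game -/

theorem PairGame.isUp_or_isDown_of_isStep {G : PairGame} {s : StepType} {v w : G.V}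
    (h : G.IsStep s v w) : (s.IsDown ∧ G.IsUp w v) ∨ (¬ s.IsDown ∧ G.IsUp v w) := by
  cases s
  · exact Or.inr ⟨id, Or.inl h⟩
  · exact Or.inl ⟨trivial, Or.inl h⟩
  · exact Or.inr ⟨id, Or.inr (Or.inl h)⟩
  · exact Or.inl ⟨trivial, Or.inr (Or.inr h)⟩
  · exact Or.inr ⟨id, Or.inr (Or.inr h)⟩
  · exact Or.inl ⟨trivial, Or.inr (Or.inl h)⟩

/-- Reversal exchanges lu with rd and ru with ld, hence the crossing of the last two alternatives.
-/
theorem PairGame.isDown_iff {G : PairGame} {v w : G.V} : G.IsDown v w ↔ G.IsUp w v :=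
  ⟨fun h => h.elim Or.inl fun h => h.elim (fun h => Or.inr (Or.inr h)) fun h => Or.inr (Or.inl h),
    fun h => h.elim Or.inl fun h => h.elim (fun h => Or.inr (Or.inr h)) fun h => Or.inr (Or.inl h)⟩

namespace GuardedGame

variable {G : PairGame} {n : ℕ}

theorem not_isUp_of_isUp (g : GuardedGame G n) {v w : G.V} (h : G.IsUp v w) :
    ¬ G.IsUp w v := fun h' => by
  have := g.level_up _ _ h
  have := g.level_up _ _ h'
  omega

/-- `IsUp` speaks of a pair of vertices and `StepType.IsDown` of a label. They match because the
level changes strictly along an edge, so no pair is joined in both directions. -/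
theorem isUp_iff (g : GuardedGame G n) {s : StepType} {v w : G.V} (h : G.IsStep s v w) :
    G.IsUp v w ↔ ¬ s.IsDown := by
  rcases PairGame.isUp_or_isDown_of_isStep h with ⟨h1, h2⟩ | ⟨h1, h2⟩
  · simp [h1, g.not_isUp_of_isUp h2]
  · simp [h1, h2]

theorem isDown_iff (g : GuardedGame G n) {s : StepType} {v w : G.V} (h : G.IsStep s v w) :
    G.IsDown v w ↔ s.IsDown := by
  rw [PairGame.isDown_iff]
  rcases PairGame.isUp_or_isDown_of_isStep h with ⟨h1, h2⟩ | ⟨h1, h2⟩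
  · simp [h1, h2]
  · simp [h1, g.not_isUp_of_isUp h2]

/-- For `m = n` the outermost vertices are the outcomes. Up–down visits occur only there, so
simplicity yields (i); the sets `NUp`, `NCirc`, `NDown` consist of visits to internal vertices of
rank 0, 1, 2, so the strict increase of the rank yields (ii). -/
theorem exists_isToomCycle (g : GuardedGame G n) (hn : 1 ≤ n) :
    ∃ (l : ℕ) (ψ : ℕ → G.V), G.IsToomCycle l ψ ∧ ∀ k ≤ l, g.safe (ψ k) := by
  obtain ⟨L, hL, hsimple⟩ := g.exists_isCycle n le_rfl
  obtain ⟨l, hl⟩ : ∃ l, L.length = l + 1 := by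
    cases L with
    | nil => simpa using hL.head
    | cons a L => exact ⟨L.length, by simp⟩
  obtain ⟨a, ha⟩ : ∃ a : ℕ → Visit G.V, ∀ k (hk : k < L.length), a k = L[k] :=
    ⟨fun k => L.getD k ⟨G.root, none, none⟩, fun k hk => by simp [hk]⟩
  have step : ∀ k < l, ∃ s, (a k).out = some s ∧ (a (k + 1)).inc = some s ∧
      G.IsStep s (a k).vertex (a (k + 1)).vertex := fun k hk => by
    rw [ha k (by omega), ha (k + 1) (by omega)]
    exact List.isChain_iff_getElem.1 hL.chain k (by omega)
  have rule : ∀ k ≤ l, (g.level (a k).vertex < n ∧ InnerRule (a k).inc (a k).out) ∨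
      (g.level (a k).vertex = n ∧ OuterRule (g.turn n) (a k).inc (a k).out) := fun k hk => by
    rw [ha k (by omega)]
    exact hL.rule _ (List.getElem_mem _)
  have order : ∀ j k, j < k → k ≤ l → (a j).vertex = (a k).vertex →
      g.level (a j).vertex < n → (a j).rank < (a k).rank := fun j k hjk hk => by
    rw [ha j (by omega), ha k (by omega)]
    exact List.pairwise_iff_getElem.1 hL.order j k (by omega) (by omega) hjk
  have simple : ∀ j k, j < k → k ≤ l → (a j).vertex = (a k).vertex →
      g.level (a j).vertex ≠ n := fun j k hjk hk => by
    rw [ha j (by omega), ha k (by omega)]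
    exact List.pairwise_iff_getElem.1 hsimple j k (by omega) (by omega) hjk
  have first : (a 0).vertex = G.root ∧ (a 0).inc = none := by
    have := hL.head
    rw [List.head?_eq_getElem?, List.getElem?_eq_getElem (by omega), ← ha 0 (by omega)] at this
    simpa using this
  have last : (a l).vertex = G.root ∧ (a l).out = none := by
    have := hL.last
    rw [List.getLast?_eq_getElem?, hl, Nat.add_sub_cancel, List.getElem?_eq_getElem (by omega),
      ← ha l (by omega)] at this
    simpa using this
  -- As `1 ≤ n`, the root is not outermost, so the walk really leaves it and returns.
  have rule_first : InnerRule none (a 0).out := by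
    have := rule 0 (by omega)
    rw [first.1, first.2, g.level_root] at this
    exact (this.resolve_right fun h => by omega).2
  have rule_last : InnerRule (a l).inc none := by
    have := rule l le_rfl
    rw [last.1, last.2, g.level_root] at this
    exact (this.resolve_right fun h => by omega).2
  have hl2 : 2 ≤ l := by
    by_contra hlt
    obtain rfl | rfl : l = 0 ∨ l = 1 := by omega
    · rw [last.2] at rule_first
      cases rule_first
    · obtain ⟨s, hs, hs', -⟩ := step 0 (by omega)
      rw [hs] at rule_first
      rw [hs'] at rule_last
      cases rule_first <;> cases rule_last
  have inside : ∀ k, 0 < k → k < l → ∃ s t, (a k).inc = some s ∧ (a k).out = some t ∧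
      G.IsStep s (a (k - 1)).vertex (a k).vertex ∧ G.IsStep t (a k).vertex (a (k + 1)).vertex := by
    intro k hk0 hkl
    obtain ⟨s, -, hs, hstep⟩ := step (k - 1) (by omega)
    obtain ⟨t, ht, -, hstep'⟩ := step k hkl
    rw [Nat.sub_add_cancel hk0] at hs hstep
    exact ⟨s, t, hs, ht, hstep, hstep'⟩
  have inner_of : ∀ k ≤ l, g.level (a k).vertex < n → InnerRule (a k).inc (a k).out :=
    fun k hk h => ((rule k hk).resolve_right fun h' => by omega).2
  have outer_of : ∀ k ≤ l, ¬ g.level (a k).vertex < n → OuterRule (g.turn n) (a k).inc (a k).out :=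
    fun k hk h => ((rule k hk).resolve_left fun h' => h h'.1).2
  have rank_of : ∀ i : Fin 3, ∀ k ∈ G.NSet l (fun k => (a k).vertex) i,
      k ≤ l ∧ g.level (a k).vertex < n ∧ (a k).rank = i := by
    intro i k hk
    -- A visit with both steps to an outermost vertex is up–down, which the disjunction `s.IsDown ∨
    -- ¬ t.IsDown` rules out.
    have key : (0 < k ∧ k < l) → ∀ i : ℕ, (∀ s t, (a k).inc = some s → (a k).out = some t →
        G.IsStep s (a (k - 1)).vertex (a k).vertex →
        G.IsStep t (a k).vertex (a (k + 1)).vertex → (s.IsDown ∨ ¬ t.IsDown) ∧ (a k).rank = i) →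
        k ≤ l ∧ g.level (a k).vertex < n ∧ (a k).rank = i := by
      rintro ⟨hk0, hkl⟩ i h
      obtain ⟨s, t, hs, ht, hstep, hstep'⟩ := inside k hk0 hkl
      obtain ⟨h1, h2⟩ := h s t hs ht hstep hstep'
      refine ⟨hkl.le, ?_, h2⟩
      by_contra hlev
      have := outer_of k hkl.le hlev
      rw [hs, ht] at this
      generalize g.turn n = p at this
      cases this <;> simp [StepType.IsDown] at h1
    fin_cases i
    · rcases hk with ⟨hk0, hkl, hk1, hk2⟩ | rfl
      · refine key ⟨hk0, hkl⟩ 0 fun s t hs ht hstep hstep' => ?_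
        have h1 := (g.isUp_iff hstep).1 hk1
        have h2 := (g.isUp_iff hstep').1 hk2
        simp [Visit.rank, hs, ht, h1, h2]
      -- In `rank` a missing incoming step counts as up and a missing outgoing step as down, in
      -- accordance with 0 ∈ N_↑ and `l` ∈ N_↓.
      · refine ⟨by omega, by rw [first.1, g.level_root]; omega, ?_⟩
        revert rule_first
        rw [Visit.rank, first.2]
        generalize (a 0).out = t
        intro h
        cases h <;> simp [StepType.IsDown]
    · obtain ⟨hk0, hkl, hk1, hk2⟩ := hk
      refine key ⟨hk0, hkl⟩ 1 fun s t hs ht hstep hstep' => ?_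
      have h1 := (g.isDown_iff hstep).1 hk1
      have h2 := (g.isUp_iff hstep').1 hk2
      simp [Visit.rank, hs, ht, h1, h2]
    · rcases hk with ⟨hk0, hkl, hk1, hk2⟩ | rfl
      · refine key ⟨hk0, hkl⟩ 2 fun s t hs ht hstep hstep' => ?_
        have h1 := (g.isDown_iff hstep).1 hk1
        have h2 := (g.isDown_iff hstep').1 hk2
        simp [Visit.rank, hs, ht, h1, h2]
      · refine ⟨by omega, by rw [last.1, g.level_root]; omega, ?_⟩
        revert rule_last
        rw [Visit.rank, last.2]
        generalize (a k).inc = t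
        intro h
        cases h <;> simp [StepType.IsDown]
  have star_level : ∀ k ∈ G.NStar l (fun k => (a k).vertex), k ≤ l ∧ g.level (a k).vertex = n := by
    rintro k ⟨hk0, hkl, hk1, hk2⟩
    obtain ⟨s, t, hs, ht, hstep, hstep'⟩ := inside k hk0 hkl
    have h1 := (g.isUp_iff hstep).1 hk1
    have h2 := (g.isDown_iff hstep').1 hk2
    refine ⟨hkl.le, ((rule k hkl.le).resolve_left ?_).1⟩
    rintro ⟨-, h⟩
    rw [hs, ht] at h
    rcases h with _ | _ | _ | _ | h
    cases h <;> simp [StepType.IsDown] at h1 h2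
  refine ⟨l, fun k => (a k).vertex, ⟨hl2, ?_, first.1, last.1, ?_, ?_, ?_, ?_, ?_, ?_⟩, ?_⟩
  · intro k hk
    obtain ⟨s, -, -, hstep⟩ := step k hk
    rcases PairGame.isUp_or_isDown_of_isStep hstep with ⟨-, h⟩ | ⟨-, h⟩
    · exact Or.inr (g.edge_of_up _ _ h)
    · exact Or.inl (g.edge_of_up _ _ h)
  · obtain ⟨s, hs, -, hstep⟩ := step 0 (by omega)
    rw [hs] at rule_first
    cases rule_first
    · exact Or.inl hstep
    · exact Or.inr hstep
  · obtain ⟨s, -, hs, hstep⟩ := step (l - 1) (by omega)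
    rw [Nat.sub_add_cancel (by omega)] at hs hstep
    rw [hs] at rule_last
    cases rule_last
    · exact Or.inl hstep
    · exact Or.inr hstep
  · intro k hk0 hkl hE
    obtain ⟨s, t, hs, ht, hstep, hstep'⟩ := inside k hk0 hkl
    have h := inner_of k hkl.le ((g.interior_iff _).1 hE)
    rw [hs, ht] at h
    rcases h with _ | _ | _ | _ | h
    exact ⟨s, t, hstep, hstep', h⟩
  · intro k hk0 hkl hE
    obtain ⟨s, t, hs, ht, hstep, hstep'⟩ := inside k hk0 hkl
    have h := outer_of k hkl.le fun h => hE ((g.interior_iff _).2 h)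
    rw [hs, ht] at h
    exact ⟨s, t, hstep, hstep', h.boundaryRule⟩
  · intro k hk m hm hkm heq
    obtain ⟨hkl, hklev⟩ := star_level k hk
    obtain ⟨hml, hmlev⟩ := star_level m hm
    rcases lt_or_gt_of_ne hkm with h | h
    · exact simple k m h hml heq hklev
    · exact simple m k h hkl heq.symm hmlev
  · intro s t hst k hk m hm heq
    obtain ⟨hkl, hklev, hkr⟩ := rank_of s k hk
    obtain ⟨hml, hmlev, hmr⟩ := rank_of t m hm
    by_contra hlt
    have := order m k (by omega) hkl heq.symm hmlev
    rw [hkr, hmr] at this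
    exact absurd hst (not_le.2 (Fin.lt_def.2 this))
  · intro k hk
    simp only [ha k (by omega)]
    exact hL.safe _ (List.getElem_mem _)

end GuardedGame

/-! ### Winning strategies guard the set of winning states -/

namespace GameGraph

variable {G : GameGraph}

theorem next_of_alice (σ₁ : G.Strategy Player.alice) (σ₂ : G.Strategy Player.bob) {v : G.Interior}
    (h : G.turn v = Player.alice) : next σ₁ σ₂ v = σ₁ ⟨v, h⟩ := by
  unfold next
  split
  · rfl
  · rename_i h'
    exact Player.noConfusion (h.symm.trans h')

theorem next_of_bob (σ₁ : G.Strategy Player.alice) (σ₂ : G.Strategy Player.bob) {v : G.Interior}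
    (h : G.turn v = Player.bob) : next σ₁ σ₂ v = σ₂ ⟨v, h⟩ := by
  unfold next
  split
  · rename_i h'
    exact Player.noConfusion (h.symm.trans h')
  · rfl

theorem outcomeFrom_of_interior (σ₁ : G.Strategy Player.alice) (σ₂ : G.Strategy Player.bob)
    (v : G.Interior) : outcomeFrom σ₁ σ₂ v.1 = outcomeFrom σ₁ σ₂ (next σ₁ σ₂ v).1 := by
  rw [outcomeFrom_eq, dif_pos v.2]

theorem outcomeFrom_of_boundary (σ₁ : G.Strategy Player.alice) (σ₂ : G.Strategy Player.bob)
    (v : G.Boundary) : outcomeFrom σ₁ σ₂ v.1 = v := by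
  rw [outcomeFrom_eq, dif_neg v.2]

/-- The play from `v` consults Bob's strategy only at states reachable from `v`. -/
theorem outcomeFrom_congr (σ₁ : G.Strategy Player.alice) {σ₂ τ₂ : G.Strategy Player.bob} (v : G.V)
    (h : ∀ u, Relation.ReflTransGen G.E v u.1.1 → σ₂ u = τ₂ u) :
    outcomeFrom σ₁ σ₂ v = outcomeFrom σ₁ τ₂ v := by
  induction v using G.wellFounded_flip.induction with
  | _ v ih =>
    by_cases hv : ∃ w, G.E v w
    · have hnext : next σ₁ σ₂ ⟨v, hv⟩ = next σ₁ τ₂ ⟨v, hv⟩ := by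
        cases ht : G.turn ⟨v, hv⟩
        · rw [next_of_alice _ _ ht, next_of_alice _ _ ht]
        · rw [next_of_bob _ _ ht, next_of_bob _ _ ht, h _ .refl]
      rw [outcomeFrom_of_interior _ _ ⟨v, hv⟩, outcomeFrom_of_interior _ _ ⟨v, hv⟩, ← hnext]
      exact ih _ (next σ₁ σ₂ ⟨v, hv⟩).2 fun u hu => h u (hu.head (next σ₁ σ₂ ⟨v, hv⟩).2)
    · rw [outcomeFrom_of_boundary _ _ ⟨v, hv⟩, outcomeFrom_of_boundary _ _ ⟨v, hv⟩]

/-- Alice wins from the state `v` with the strategy `σ₁`. -/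
def WinsFrom (x : G.Boundary → Fin 2) (σ₁ : G.Strategy Player.alice) (v : G.V) : Prop :=
  ∀ σ₂ : G.Strategy Player.bob, x (outcomeFrom σ₁ σ₂ v) = 0

variable {x : G.Boundary → Fin 2} {σ₁ : G.Strategy Player.alice}

theorem WinsFrom.of_alice {v : G.Interior} (hv : WinsFrom x σ₁ v.1)
    (h : G.turn v = Player.alice) : WinsFrom x σ₁ (σ₁ ⟨v, h⟩).1 := fun σ₂ => by
  have := hv σ₂
  rwa [outcomeFrom_of_interior, next_of_alice _ _ h] at this

/-- Redirect Bob's strategy at `v` towards `w`. By acyclicity the play from `w` never returns to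
`v`, so its outcome is unchanged and equals that of the redirected play from `v`, which Alice wins.
-/
theorem WinsFrom.of_bob {v : G.Interior} (hv : WinsFrom x σ₁ v.1) (h : G.turn v = Player.bob)
    {w : G.V} (hw : G.E v.1 w) : WinsFrom x σ₁ w := fun σ₂ => by
  classical
  let τ₂ : G.Strategy Player.bob := Function.update σ₂ ⟨v, h⟩ ⟨w, hw⟩
  have hτ₂ : τ₂ ⟨v, h⟩ = ⟨w, hw⟩ := Function.update_self ..
  have := hv τ₂
  rw [outcomeFrom_of_interior, next_of_bob _ _ h, hτ₂] at this
  rw [← this]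
  congr 1
  refine outcomeFrom_congr σ₁ w fun u hu => (Function.update_of_ne ?_ _ σ₂).symm
  rintro rfl
  exact G.acyclic _ (Relation.TransGen.head' hw hu)

theorem WinsFrom.eq_zero {v : G.Boundary} (hv : WinsFrom x σ₁ v.1) : x v = 0 := by
  -- `WinsFrom` quantifies over Bob's strategies, so at least one has to be exhibited; an arbitrary
  -- choice of edges will do.
  let σ₂ : G.Strategy Player.bob := fun u => ⟨u.1.2.choose, u.1.2.choose_spec⟩
  have := hv σ₂
  rwa [outcomeFrom_of_boundary] at this

end GameGraph

/-! ### Alternating games and their safe states. -/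

/-- A game-graph of depth `n` that is graded by the distance to the root and in which the players
move in turns along the edges of their decision graphs. -/
structure AlternatingGame (G : PairGame) (n : ℕ) where
  level : G.V → ℕ
  turn : ℕ → Player
  turn_succ : ∀ m, turn (m + 1) = Player.alice ↔ turn m = Player.bob
  level_root : level G.root = 0
  level_edge : ∀ v w, G.E v w → level w = level v + 1
  interior_iff : ∀ v, (∃ w, G.E v w) ↔ level v < n
  turn_eq : ∀ v, G.turn v = turn (level v.1)
  edge_iff_alice : ∀ v w, G.IsTurn Player.alice v → (G.E v w ↔ ∃ k, G.AEdge k v w)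
  edge_of_bob : ∀ v w k, G.BEdge k v w → G.E v w
  exists_bEdge : ∀ v k, G.IsTurn Player.bob v → ∃ w, G.BEdge k v w

namespace AlternatingGame

variable {G : PairGame} {n : ℕ}

theorem edge_of_isUp (g : AlternatingGame G n) {v w : G.V} (h : G.IsUp v w) : G.E v w := by
  rcases h with ⟨k, h⟩ | h | h
  · exact (g.edge_iff_alice _ _ h.1).2 ⟨k, h⟩
  · exact g.edge_of_bob _ _ _ h
  · exact g.edge_of_bob _ _ _ h

theorem isTurn (g : AlternatingGame G n) {v : G.V} {p : Player} (hv : g.level v < n)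
    (ht : g.turn (g.level v) = p) : G.IsTurn p v := ⟨(g.interior_iff v).2 hv, (g.turn_eq _).trans ht⟩

open Classical in
/-- The states from which Alice wins are guarded by a winning strategy. -/
noncomputable def guarded (g : AlternatingGame G n) {x : G.Boundary → Fin 2}
    {σ₁ : G.Strategy Player.alice} (h : GameGraph.IsWinningForAlice x σ₁) : GuardedGame G n where
  level := g.level
  turn := g.turn
  turn_succ := g.turn_succ
  level_root := g.level_root
  level_up v w h := g.level_edge v w (g.edge_of_isUp h)
  edge_of_up v w h := g.edge_of_isUp h
  interior_iff := g.interior_iff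
  safe := GameGraph.WinsFrom x σ₁
  safe_root := h
  aliceMove v := if hv : G.IsTurn Player.alice v then (σ₁ ⟨⟨v, hv.1⟩, hv.2⟩).1 else v
  aliceMove_spec v hs hv ht := by
    have hv := g.isTurn hv ht
    rw [dif_pos hv]
    exact ⟨(g.edge_iff_alice _ _ hv).1 (σ₁ ⟨⟨v, hv.1⟩, hv.2⟩).2,
      GameGraph.WinsFrom.of_alice (v := ⟨v, hv.1⟩) hs hv.2⟩
  bobMove k v := if hv : G.IsTurn Player.bob v then (g.exists_bEdge v k hv).choose else v
  bobMove_spec v hs hv ht k := by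
    have hv := g.isTurn hv ht
    rw [dif_pos hv]
    have hk := (g.exists_bEdge v k hv).choose_spec
    exact ⟨hk, GameGraph.WinsFrom.of_bob (v := ⟨v, hv.1⟩) hs hv.2 (g.edge_of_bob _ _ _ hk)⟩

theorem exists_present_isToomCycle (g : AlternatingGame G n) (hn : 1 ≤ n) {x : G.Boundary → Fin 2}
    (hx : ∃ σ₁ : G.Strategy Player.alice, GameGraph.IsWinningForAlice x σ₁) :
    ∃ (l : ℕ) (ψ : ℕ → G.V), G.IsToomCycle l ψ ∧ G.IsPresent x l ψ := by
  obtain ⟨σ₁, h⟩ := hx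
  obtain ⟨l, ψ, hψ, hs⟩ := (g.guarded h).exists_isToomCycle hn
  exact ⟨l, ψ, hψ, fun k hk hb => GameGraph.WinsFrom.eq_zero (v := ⟨ψ k, hb⟩) (hs k hk)⟩

end AlternatingGame

/-! ### Games on products -/

theorem DecisionGraph.truncate_interior_iff (D : DecisionGraph) (n : ℕ) (t : ℕ → Player)
    (v : (D.truncate n t).V) : (∃ w, (D.truncate n t).E v w) ↔ D.level v.1 < n := by
  constructor
  · rintro ⟨w, hw⟩
    have h1 := D.level_succ hw
    have h2 := w.2
    omega
  · intro hv
    obtain ⟨w, hw⟩ := D.exists_out v.1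
    exact ⟨⟨w, by rw [D.level_succ hw]; omega⟩, hw⟩

theorem DecisionGraph.level_ltimes (D₁ D₂ : DecisionGraph) (v : (D₁.ltimes D₂).V) :
    (D₁.ltimes D₂).level v = D₁.level v.1.1 + D₂.level v.1.2 :=
  level_ofLevel (ℓ := fun p : {p : D₁.V × D₂.V // IsLtimesVertex D₁ D₂ p} =>
    D₁.level p.1.1 + D₂.level p.1.2) ..

theorem DecisionGraph.level_rtimes (D₁ D₂ : DecisionGraph) (v : (D₁.rtimes D₂).V) :
    (D₁.rtimes D₂).level v = D₂.level v.1.2 + D₁.level v.1.1 :=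
  level_ofLevel (ℓ := fun p : {p : D₁.V × D₂.V // IsLtimesVertex D₂ D₁ p.swap} =>
    D₂.level p.1.2 + D₁.level p.1.1) ..

/-- The parity of |a| + |b| tells whose turn it is, and as |a| − |b| is 0 or 1 it also determines
this difference. Hence the turn decides which coordinate moves along the edges out of a state. -/
theorem ltimesGame.level_of_alice {A B : BinaryDecisionGraph} {n : ℕ} {v : (ltimesGame A B n).V}
    (hv : (ltimesGame A B n).IsTurn Player.alice v) : A.level v.1.1.1 = B.level v.1.1.2 := by
  obtain ⟨_, ht⟩ := hv
  have he : Even ((A.toDecisionGraph.ltimes B.toDecisionGraph).level v.1) := by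
    by_contra he
    exact Player.noConfusion ((if_neg he).symm.trans ht)
  rw [DecisionGraph.level_ltimes, Nat.even_iff] at he
  have hv : A.level v.1.1.1 = B.level v.1.1.2 ∨ A.level v.1.1.1 = B.level v.1.1.2 + 1 := v.1.2
  omega

theorem ltimesGame.level_of_bob {A B : BinaryDecisionGraph} {n : ℕ} {v : (ltimesGame A B n).V}
    (hv : (ltimesGame A B n).IsTurn Player.bob v) : A.level v.1.1.1 = B.level v.1.1.2 + 1 := by
  obtain ⟨_, ht⟩ := hv
  have he : ¬ Even ((A.toDecisionGraph.ltimes B.toDecisionGraph).level v.1) := by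
    intro he
    exact Player.noConfusion ((if_pos he).symm.trans ht)
  rw [DecisionGraph.level_ltimes, Nat.even_iff] at he
  have hv : A.level v.1.1.1 = B.level v.1.1.2 ∨ A.level v.1.1.1 = B.level v.1.1.2 + 1 := v.1.2
  omega

theorem rtimesGame.level_of_alice {A B : BinaryDecisionGraph} {n : ℕ} {v : (rtimesGame A B n).V}
    (hv : (rtimesGame A B n).IsTurn Player.alice v) : B.level v.1.1.2 = A.level v.1.1.1 + 1 := by
  obtain ⟨_, ht⟩ := hv
  have he : ¬ Even ((A.toDecisionGraph.rtimes B.toDecisionGraph).level v.1) := by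
    intro he
    exact Player.noConfusion ((if_pos he).symm.trans ht)
  rw [DecisionGraph.level_rtimes, Nat.even_iff] at he
  have hv : B.level v.1.1.2 = A.level v.1.1.1 ∨ B.level v.1.1.2 = A.level v.1.1.1 + 1 := v.1.2
  omega

theorem rtimesGame.level_of_bob {A B : BinaryDecisionGraph} {n : ℕ} {v : (rtimesGame A B n).V}
    (hv : (rtimesGame A B n).IsTurn Player.bob v) : B.level v.1.1.2 = A.level v.1.1.1 := by
  obtain ⟨_, ht⟩ := hv
  have he : Even ((A.toDecisionGraph.rtimes B.toDecisionGraph).level v.1) := by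
    by_contra he
    exact Player.noConfusion ((if_neg he).symm.trans ht)
  rw [DecisionGraph.level_rtimes, Nat.even_iff] at he
  have hv : B.level v.1.1.2 = A.level v.1.1.1 ∨ B.level v.1.1.2 = A.level v.1.1.1 + 1 := v.1.2
  omega

/-- The grading of `G_n(A ⋉ B)`. -/
noncomputable def ltimesGame.alternating (A B : BinaryDecisionGraph) (n : ℕ) :
    AlternatingGame (ltimesGame A B n) n where
  level v := (A.toDecisionGraph.ltimes B.toDecisionGraph).level v.1
  turn m := if Even m then Player.alice else Player.bob
  turn_succ m := by by_cases h : Even m <;> simp [Nat.even_add_one, h]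
  level_root := DecisionGraph.level_root _
  level_edge _ _ h := DecisionGraph.level_succ _ h
  interior_iff := DecisionGraph.truncate_interior_iff _ _ _
  turn_eq _ := rfl
  edge_iff_alice v w hv := by
    have hl := ltimesGame.level_of_alice hv
    constructor
    · rintro (⟨-, h1, h2⟩ | ⟨h, -⟩)
      · obtain ⟨k, hk⟩ := (A.edge_iff _ _).1 h1
        exact ⟨k, hv, Prod.ext hk h2⟩
      · omega
    · rintro ⟨k, -, hk⟩
      have hk : w.1.1 = (A.move v.1.1.1 k, v.1.1.2) := hk
      exact Or.inl ⟨hl, (A.edge_iff _ _).2 ⟨k, (Prod.ext_iff.1 hk).1⟩, (Prod.ext_iff.1 hk).2⟩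
  edge_of_bob v w k h := by
    have hk : w.1.1 = (v.1.1.1, B.move v.1.1.2 k) := h.2
    exact Or.inr ⟨ltimesGame.level_of_bob h.1, (Prod.ext_iff.1 hk).1,
      (B.edge_iff _ _).2 ⟨k, (Prod.ext_iff.1 hk).2⟩⟩
  exists_bEdge v k hv := by
    have hl := ltimesGame.level_of_bob hv
    have hk := B.level_succ ((B.edge_iff v.1.1.2 _).2 ⟨k, rfl⟩)
    have hn := (DecisionGraph.truncate_interior_iff _ _ _ v).1 hv.1
    rw [DecisionGraph.level_ltimes] at hn
    exact ⟨⟨⟨(v.1.1.1, B.move v.1.1.2 k), Or.inl (by simp only; omega)⟩,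
      (DecisionGraph.level_ltimes _ _ _).trans_le (by simp only; omega)⟩, hv, rfl⟩

/-- The grading of `G'_n(A ⋊ B)`. -/
noncomputable def rtimesGame.alternating (A B : BinaryDecisionGraph) (n : ℕ) :
    AlternatingGame (rtimesGame A B n) n where
  level v := (A.toDecisionGraph.rtimes B.toDecisionGraph).level v.1
  turn m := if Even m then Player.bob else Player.alice
  turn_succ m := by by_cases h : Even m <;> simp [Nat.even_add_one, h]
  level_root := DecisionGraph.level_root _
  level_edge _ _ h := DecisionGraph.level_succ _ h
  interior_iff := DecisionGraph.truncate_interior_iff _ _ _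
  turn_eq _ := rfl
  edge_iff_alice v w hv := by
    have hl := rtimesGame.level_of_alice hv
    constructor
    · rintro (⟨h, -⟩ | ⟨-, h2, h1⟩)
      · exact absurd (h.symm.trans hl) (by simp)
      · obtain ⟨k, hk⟩ := (A.edge_iff _ _).1 h1
        exact ⟨k, hv, Prod.ext hk h2⟩
    · rintro ⟨k, -, hk⟩
      have hk : w.1.1 = (A.move v.1.1.1 k, v.1.1.2) := hk
      exact Or.inr ⟨hl, (Prod.ext_iff.1 hk).2, (A.edge_iff _ _).2 ⟨k, (Prod.ext_iff.1 hk).1⟩⟩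
  edge_of_bob v w k h := by
    have hk : w.1.1 = (v.1.1.1, B.move v.1.1.2 k) := h.2
    exact Or.inl ⟨rtimesGame.level_of_bob h.1,
      (B.edge_iff _ _).2 ⟨k, (Prod.ext_iff.1 hk).2⟩, (Prod.ext_iff.1 hk).1⟩
  exists_bEdge v k hv := by
    have hl := rtimesGame.level_of_bob hv
    have hk := B.level_succ ((B.edge_iff v.1.1.2 _).2 ⟨k, rfl⟩)
    have hn := (DecisionGraph.truncate_interior_iff _ _ _ v).1 hv.1
    rw [DecisionGraph.level_rtimes] at hn
    exact ⟨⟨⟨(v.1.1.1, B.move v.1.1.2 k), Or.inr (by simp only [Prod.swap]; omega)⟩,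
      (DecisionGraph.level_rtimes _ _ _).trans_le (by simp only; omega)⟩, hv, rfl⟩

end MinimaxGame

open MinimaxGame in
theorem theorem2p5 (n : ℕ) (hn : 1 ≤ n) (G : PairGame)
    (hG : G = ltimesGame tree quadrant n ∨ G = rtimesGame tree quadrant n ∨
      G = ltimesGame quadrant quadrant n ∨ G = rtimesGame quadrant quadrant n)
    (x : G.Boundary → Fin 2)
    (hx : ∃ σ₁ : G.Strategy Player.alice, GameGraph.IsWinningForAlice x σ₁) :
    ∃ (l : ℕ) (ψ : ℕ → G.V), G.IsToomCycle l ψ ∧ G.IsPresent x l ψ := by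
  rcases hG with rfl | rfl | rfl | rfl
  · exact (ltimesGame.alternating _ _ n).exists_present_isToomCycle hn hx
  · exact (rtimesGame.alternating _ _ n).exists_present_isToomCycle hn hx
  · exact (ltimesGame.alternating _ _ n).exists_present_isToomCycle hn hx
  · exact (rtimesGame.alternating _ _ n).exists_present_isToomCycle hn hx
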